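/- Let $n$ be a positive integer. For $x\in\mathbb{Z}/n\mathbb{Z}$ let $(x)_n\in\{0,\dots,n-1\}$ denote its least nonnegative representative. A finite (unordered) sequence $S=(a_1)\cdots(a_k)$ over $\mathbb{Z}/n\mathbb{Z}$ is \emph{minimal zero-sum} if $a_1+\dots+a_k=0$ and no proper nonempty subsequence of $S$ has sum $0$. Its \emph{index} is $$\operatorname{ind}(S)=\min\left\{\frac{1}{n}\sum_{i=1}^{k}(g a_i)_n \;:\; 0\le g<n,\ \gcd(g,n)=1\right\}.$$ Say that the \emph{index conjecture (in the form of Shen et al.) holds for} $n$ if every minimal zero-sum sequence $S=(a_1)(a_2)(a_3)(a_4)$ of length $4$ over $\mathbb{Z}/n\mathbb{Z}$ with $\gcd(n,a_i)=1$ for $i=1,2,3,4$ satisfies $\operatorname{ind}(S)=1$. \textbf{Theorem.} Let $n$ be coprime to $6$ and to $7$. Then the index conjecture (in the form of Shen et al.) holds for $n$ in each of the following cases: \begin{itemize} \item $n>3.4\cdot 10^{13}$; \item $n$ is also coprime to $11$, and $n>2.9\cdot 10^{13}$; \item $n$ is also coprime to $11$ and $13$, and $n>2.6\cdot 10^{13}$;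 \item $n$ is also coprime to $11$, $13$ and $17$, and $n>2.3\cdot 10^{13}$; \item $n$ is also coprime to $11$, $13$, $17$ and $19$, and $n>2.2\cdot 10^{13}$. \end{itemize} -/

import Mathlib

namespace IndexConjecture

/-- A finite sequence over `ZMod n` (order is irrelevant, repetition is allowed) is *zero-sum* if its
terms add up to `0`; it is *minimal* zero-sum if moreover no proper nonempty subsequence is zero-sum. -/
def IsMinimalZeroSum {n : ℕ} (S : Multiset (ZMod n)) : Prop :=
  S.sum = 0 ∧ ∀ T : Multiset (ZMod n), T ≤ S → T ≠ 0 → T ≠ S → T.sum ≠ 0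

/-- The residues `g ∈ {0, …, n - 1}` that are coprime to `n`. -/
def coprimeResidues (n : ℕ) : Finset ℕ :=
  (Finset.range n).filter fun g => Nat.Coprime n g

theorem coprimeResidues_nonempty (n : ℕ) [NeZero n] : (coprimeResidues n).Nonempty := by
  have hn : 0 < n := Nat.pos_of_ne_zero (NeZero.ne n)
  refine ⟨1 % n, ?_⟩
  simp only [coprimeResidues, Finset.mem_filter, Finset.mem_range]
  refine ⟨Nat.mod_lt _ hn, ?_⟩
  rcases Nat.lt_or_ge 1 n with h | h
  · rw [Nat.mod_eq_of_lt h]; exact Nat.coprime_one_right n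
  · obtain rfl : n = 1 := by omega
    exact Nat.coprime_one_left _

/-- The rational number `(∑ (g a)_n) / n`, the sum running over the terms `a` of `S`, where `(x)_n`
is the least nonnegative representative of `x`. -/
def weight {n : ℕ} (S : Multiset (ZMod n)) (g : ℕ) : ℚ :=
  (((S.map fun a => ((g : ZMod n) * a).val).sum : ℕ) : ℚ) / n

/-- The index of `S`: the minimum of `(∑ (g a)_n) / n` over the residues `g` coprime to `n`. -/
def index {n : ℕ} [NeZero n] (S : Multiset (ZMod n)) : ℚ :=
  (coprimeResidues n).inf' (coprimeResidues_nonempty n) (weight S)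

/-- The assertion of the index conjecture (in the form of Shen et al.) for the modulus `n`: every
minimal zero-sum sequence of length `4` over `ZMod n`, all of whose terms are coprime to `n`,
has index `1`. -/
def HoldsFor (n : ℕ) [NeZero n] : Prop :=
  ∀ S : Multiset (ZMod n), S.card = 4 → IsMinimalZeroSum S →
    (∀ a ∈ S, Nat.Coprime n a.val) → index S = 1

end IndexConjecture

/-!
The index conjecture holds for *every* modulus `n > 5` coprime to `42` (`holdsFor_of_coprime`); the
numerical lower bounds on `n` are not needed beyond that.

Let `a_0, …, a_3` be units modulo `n` with sum `0`, no two of them with sum `0`. The sums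
`∑ (u a_i)_n`, for `u` a unit, are positive multiples of `n`, and those for `u` and `-u` add up to
`4 n`. So if the index is not `1`, then `∑ (u a_i)_n = 2 n` for all units `u`. Summing this against an
odd primitive character `χ⁻¹` gives `(∑ χ (a_i)) * B = 0`, where `B = ∑ χ⁻¹ y * (y)_n`. This `B` is
`-n L(0, χ⁻¹)`, hence nonzero by the functional equation and `L(1, χ) ≠ 0` (`sum_mul_val_ne_zero`).
The identification of `B` with an `L`-value uses that the Hurwitz zeta function has the value
`1 / 2 - x` at `s = 0` (`hurwitzZeta_apply_zero`). Therefore `∑ χ (a_i) = 0` for all odd primitive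
characters `χ` modulo `n` (`sum_character_eq_zero`).

By Fourier inversion on `(ℤ/n)ˣ`, this is an identity between the values of an explicit function `W`
(`primitiveWeight`), the kernel of the projection to the span of the primitive characters:
`∑ (W (a_i / a_0) - W (-a_i / a_0)) = 0` (`sum_primitiveWeight_sub_eq_zero`). The function `W` is a
product of factors over the primes `p ∣ n`. The factor at `p` is `1` at the units that are `1` modulo
the full power of `p` in `n`, and otherwise lies in `[-1 / (p - 2), 0]`. The term `W 1 = 1` has to be
balanced by the seven others, taken at units `-a_i / a_0 ≠ 1` and at `a_i / a_0`. The primes dividing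
`n` are `5` or at least `11`, so the former contribute at most `1 / 27` each (`primitiveWeight_le`),
and the latter at most `1 / 9`, or `1 / 3` if `a_i / a_0` is `1` modulo all primes `q ≠ 5` dividing `n`
(`neg_primitiveWeight_le`). The total is less than `1` unless the last case occurs for all three `i`;
then `∑ a_i = 0` becomes `4 = 0` modulo `q`. Powers of `5` have no such `q` and are treated by the
sharper bound `primitiveWeight_of_primeFactors_eq`.
-/

namespace IndexConjecture

/-! ### The Hurwitz zeta function at zero and generalized Bernoulli numbers -/

section Analysis

open Filter Topology Complex HurwitzZeta
open scoped Real

/-- Abel summation: partial sums of `b` bounded by `C` and decreasing weights `w ≥ 0` give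
weighted sums bounded by `C * w 0`. -/
theorem norm_sum_mul_antitone_le {b : ℕ → ℂ} {w : ℕ → ℝ} {C : ℝ} (hw : Antitone w)
    (hw0 : ∀ n, 0 ≤ w n) (hb : ∀ k, ‖∑ i ∈ Finset.range k, b i‖ ≤ C) (k : ℕ) :
    ‖∑ i ∈ Finset.range k, b i * w i‖ ≤ C * w 0 := by
  -- Subtracting the boundary term of the summation by parts makes the bound telescope.
  have key : ∀ k, ‖∑ i ∈ Finset.range k, b i * w i - (∑ i ∈ Finset.range k, b i) * w k‖
      ≤ C * (w 0 - w k) := by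
    intro k
    induction k with
    | zero => simp
    | succ k ih =>
      have e : ∑ i ∈ Finset.range (k + 1), b i * w i
          - (∑ i ∈ Finset.range (k + 1), b i) * w (k + 1)
          = (∑ i ∈ Finset.range k, b i * w i - (∑ i ∈ Finset.range k, b i) * w k)
          + (∑ i ∈ Finset.range (k + 1), b i) * ((w k - w (k + 1) : ℝ) : ℂ) := by
        simp only [Finset.sum_range_succ]; push_cast; ring
      rw [e]
      have hd : 0 ≤ w k - w (k + 1) := sub_nonneg.2 (hw (Nat.le_succ k))
      have h2 : ‖(∑ i ∈ Finset.range (k + 1), b i) * ((w k - w (k + 1) : ℝ) : ℂ)‖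
          ≤ C * (w k - w (k + 1)) := by
        rw [norm_mul, Complex.norm_real, Real.norm_of_nonneg hd]
        exact mul_le_mul_of_nonneg_right (hb _) hd
      calc _ ≤ _ := norm_add_le _ _
        _ ≤ C * (w 0 - w k) + C * (w k - w (k + 1)) := add_le_add ih h2
        _ = _ := by ring
  have h3 : ‖(∑ i ∈ Finset.range k, b i) * (w k : ℂ)‖ ≤ C * w k := by
    rw [norm_mul, Complex.norm_real, Real.norm_of_nonneg (hw0 k)]
    exact mul_le_mul_of_nonneg_right (hb _) (hw0 k)
  calc _ = ‖(∑ i ∈ Finset.range k, b i * w i - (∑ i ∈ Finset.range k, b i) * w k)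
        + (∑ i ∈ Finset.range k, b i) * (w k : ℂ)‖ := by ring_nf
    _ ≤ _ := norm_add_le _ _
    _ ≤ C * (w 0 - w k) + C * w k := add_le_add (key k) h3
    _ = _ := by ring

theorem norm_sub_sum_mul_antitone_le {b : ℕ → ℂ} {w : ℕ → ℝ} {C : ℝ} {f : ℂ} (hw : Antitone w)
    (hw0 : ∀ n, 0 ≤ w n) (hb : ∀ k, ‖∑ i ∈ Finset.range k, b i‖ ≤ C)
    (hf : HasSum (fun n ↦ b n * w n) f) (M : ℕ) :
    ‖f - ∑ i ∈ Finset.range M, b i * w i‖ ≤ 2 * C * w M := by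
  have ht : Tendsto (fun k ↦ ∑ i ∈ Finset.range k, b (M + i) * w (M + i)) atTop
      (𝓝 (f - ∑ i ∈ Finset.range M, b i * w i)) := by
    have h1 := (hf.tendsto_sum_nat.comp (tendsto_add_atTop_nat M)).sub_const
      (∑ i ∈ Finset.range M, b i * (w i : ℂ))
    refine h1.congr fun k ↦ ?_
    simp only [Function.comp_apply]
    rw [add_comm k M, Finset.sum_range_add]
    ring
  refine le_of_tendsto ht.norm (Eventually.of_forall fun k ↦ ?_)
  refine norm_sum_mul_antitone_le (b := fun i ↦ b (M + i)) (w := fun i ↦ w (M + i))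
    (fun i j h ↦ hw (by lia)) (fun n ↦ hw0 _) (fun k ↦ ?_) k
  have : ∑ i ∈ Finset.range k, b (M + i)
      = ∑ i ∈ Finset.range (M + k), b i - ∑ i ∈ Finset.range M, b i := by
    rw [Finset.sum_range_add]; ring
  rw [this]
  calc _ ≤ _ := norm_sub_le _ _
    _ ≤ C + C := add_le_add (hb _) (hb _)
    _ = _ := by ring

/-- The limit of the regularized sums `∑' n, b n * w t n` is the conditionally convergent sum
`∑ n, b n * v n`, provided that `b` has bounded partial sums and the decreasing weights `w t` tend to
`v`. Applied to the weights `n ^ (-s)` and `r ^ n / n`, it identifies the value at `s = 1` of a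
Dirichlet series with the boundary value of a power series. -/
theorem tendsto_sum_of_regularized {ι : Type*} {l : Filter ι} [l.NeBot] {b : ℕ → ℂ}
    {w : ι → ℕ → ℝ} {v : ℕ → ℝ} {C : ℝ} {f : ι → ℂ} {a : ℂ}
    (hb : ∀ k, ‖∑ i ∈ Finset.range k, b i‖ ≤ C)
    (hw : ∀ᶠ t in l, Antitone (w t) ∧ (∀ n, 0 ≤ w t n) ∧ HasSum (fun n ↦ b n * w t n) (f t))
    (hwv : ∀ n, Tendsto (fun t ↦ w t n) l (𝓝 (v n))) (hv : Tendsto v atTop (𝓝 0))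
    (hf : Tendsto f l (𝓝 a)) :
    Tendsto (fun M ↦ ∑ i ∈ Finset.range M, b i * v i) atTop (𝓝 a) := by
  -- The tail estimate is uniform in `t`, so it survives the limit.
  have key : ∀ M, ‖a - ∑ i ∈ Finset.range M, b i * (v i : ℂ)‖ ≤ 2 * C * v M := by
    intro M
    have h1 : Tendsto (fun t ↦ ‖f t - ∑ i ∈ Finset.range M, b i * (w t i : ℂ)‖) l
        (𝓝 ‖a - ∑ i ∈ Finset.range M, b i * (v i : ℂ)‖) := by
      refine (hf.sub (tendsto_finsetSum _ fun i _ ↦ ?_)).norm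
      exact ((continuous_ofReal.tendsto _).comp (hwv i)).const_mul _
    refine le_of_tendsto_of_tendsto h1 ((hwv M).const_mul (2 * C)) ?_
    filter_upwards [hw] with t ht
    exact norm_sub_sum_mul_antitone_le ht.1 ht.2.1 hb ht.2.2 M
  rw [tendsto_iff_norm_sub_tendsto_zero]
  refine squeeze_zero (fun _ ↦ norm_nonneg _) (fun M ↦ ?_) (by simpa using hv.const_mul (2 * C))
  rw [norm_sub_rev]
  exact key M

theorem norm_geom_sum_succ_le {z : ℂ} (hz : ‖z‖ = 1) (hz1 : z ≠ 1) (k : ℕ) :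
    ‖∑ i ∈ Finset.range k, z ^ (i + 1)‖ ≤ 2 / ‖z - 1‖ := by
  have h0 : 0 < ‖z - 1‖ := norm_pos_iff.2 (sub_ne_zero.2 hz1)
  have : ∑ i ∈ Finset.range k, z ^ (i + 1) = z * ((z ^ k - 1) / (z - 1)) := by
    rw [← geom_sum_eq hz1, Finset.mul_sum]
    exact Finset.sum_congr rfl fun i _ ↦ by ring
  rw [this, norm_mul, norm_div, hz, one_mul]
  gcongr
  calc _ ≤ ‖z ^ k‖ + ‖(1 : ℂ)‖ := norm_sub_le _ _
    _ = 2 := by rw [norm_pow, hz]; norm_num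

theorem exp_two_pi_ne_one {x : ℝ} (h0 : 0 < x) (h1 : x < 1) : cexp (2 * π * I * x) ≠ 1 := by
  intro h
  obtain ⟨m, hm⟩ := Complex.exp_eq_one_iff.1 h
  have h2 : (x : ℂ) = m := by
    have := two_pi_I_ne_zero
    apply mul_left_cancel₀ this
    rw [hm]; ring
  have h3 : x = m := by exact_mod_cast h2
  rw [h3] at h0 h1
  have h4 : (0 : ℤ) < m := by exact_mod_cast h0
  have h5 : m < (1 : ℤ) := by exact_mod_cast h1
  lia

theorem coe_addCircle_ne_zero {x : ℝ} (h0 : 0 < x) (h1 : x < 1) : (x : UnitAddCircle) ≠ 0 := by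
  intro h
  rw [← QuotientAddGroup.mk_zero, AddCircle.coe_eq_coe_iff_of_mem_Ico (a := 0)] at h
  · exact h0.ne' h
  · exact ⟨h0.le, by simpa using h1⟩
  · simp

theorem tendsto_sum_log_one_sub {z : ℂ} (hz : ‖z‖ = 1) (hz1 : z ≠ 1) :
    Tendsto (fun M ↦ ∑ i ∈ Finset.range M, z ^ (i + 1) * (((i + 1 : ℝ)⁻¹ : ℝ) : ℂ)) atTop
      (𝓝 (-log (1 - z))) := by
  refine tendsto_sum_of_regularized (l := 𝓝[<] (1 : ℝ)) (w := fun r i ↦ r ^ (i + 1) * (i + 1 : ℝ)⁻¹)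
    (f := fun r ↦ -log (1 - r * z)) (norm_geom_sum_succ_le hz hz1) ?_ ?_ ?_ ?_
  · filter_upwards [Ioo_mem_nhdsLT (zero_lt_one (α := ℝ))] with r hr
    refine ⟨fun i j hij ↦ ?_, fun i ↦ by have := hr.1; positivity, ?_⟩
    · have := hr.1
      refine mul_le_mul (pow_le_pow_of_le_one hr.1.le hr.2.le (by lia)) ?_ (by positivity)
        (by positivity)
      gcongr
    · have h1 : ‖(r : ℂ) * z‖ < 1 := by
        rw [norm_mul, hz, mul_one, Complex.norm_real, Real.norm_of_nonneg hr.1.le]; exact hr.2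
      convert! hasSum_taylorSeries_neg_log' h1 using 2 with i
      push_cast
      rw [mul_pow]; ring
  · intro i
    have : Tendsto (fun r : ℝ ↦ r ^ (i + 1) * (i + 1 : ℝ)⁻¹) (𝓝 1)
        (𝓝 (1 ^ (i + 1) * (i + 1 : ℝ)⁻¹)) := Continuous.tendsto (by fun_prop) 1
    simpa using this.mono_left nhdsWithin_le_nhds
  · simpa using tendsto_one_div_add_atTop_nhds_zero_nat (𝕜 := ℝ)
  -- `1 - z` has positive real part, so the logarithm is continuous there.
  · have hs : 1 - z ∈ slitPlane := by
      left
      have h1 : z.re ≤ 1 := hz ▸ re_le_norm z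
      rcases h1.lt_or_eq with h | h
      · simpa using h
      · exfalso
        apply hz1
        have h2 : z.re ^ 2 + z.im ^ 2 = 1 := by
          have := Complex.sq_norm z
          rw [hz, normSq_apply] at this
          nlinarith
        apply Complex.ext
        · simpa using h
        · have : z.im ^ 2 = 0 := by rw [h] at h2; linarith
          simpa using this
    have : ContinuousAt (fun r : ℝ ↦ -log (1 - r * z)) 1 := by
      refine ContinuousAt.neg (ContinuousAt.clog ?_ ?_)
      · fun_prop
      · simpa using hs
    have h2 := this.tendsto
    simp only [ofReal_one, one_mul] at h2
    exact h2.mono_left nhdsWithin_le_nhds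

/-- The exponential zeta function at `s = 1`, the edge of absolute convergence. -/
theorem expZeta_one {x : ℝ} (h0 : 0 < x) (h1 : x < 1) :
    expZeta x 1 = -log (1 - cexp (2 * π * I * x)) := by
  set z := cexp (2 * π * I * x) with hzdef
  have hz : ‖z‖ = 1 := by
    rw [hzdef, show 2 * (π : ℂ) * I * x = ((2 * π * x : ℝ) : ℂ) * I by push_cast; ring]
    exact norm_exp_ofReal_mul_I _
  have hz1 : z ≠ 1 := exp_two_pi_ne_one h0 h1
  refine tendsto_nhds_unique ?_ (tendsto_sum_log_one_sub hz hz1)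
  refine tendsto_sum_of_regularized (l := 𝓝[>] (1 : ℝ)) (w := fun s i ↦ (i + 1 : ℝ) ^ (-s))
    (f := fun s ↦ expZeta x s) (norm_geom_sum_succ_le hz hz1) ?_ ?_ ?_ ?_
  · filter_upwards [self_mem_nhdsWithin] with s hs
    have hs' : (1 : ℝ) < s := hs
    refine ⟨fun i j hij ↦ ?_, fun i ↦ by positivity, ?_⟩
    · exact Real.rpow_le_rpow_of_nonpos (by positivity) (by gcongr) (by linarith)
    · have h := hasSum_expZeta_of_one_lt_re x (s := (s : ℂ)) (by simpa using hs')
      rw [← hasSum_nat_add_iff' 1] at h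
      have hs0 : (s : ℂ) ≠ 0 := by exact_mod_cast (by linarith : s ≠ 0)
      simp only [Finset.range_one, Finset.sum_singleton, Nat.cast_zero, zero_cpow hs0, div_zero,
        sub_zero] at h
      convert! h using 2 with i
      rw [hzdef, ← Complex.exp_nat_mul, Real.rpow_neg (by positivity), div_eq_mul_inv]
      push_cast
      rw [Complex.ofReal_cpow (by positivity)]
      push_cast
      congr 2
      ring
  · intro i
    have : Tendsto (fun s : ℝ ↦ (i + 1 : ℝ) ^ (-s)) (𝓝 1) (𝓝 ((i + 1 : ℝ) ^ (-1 : ℝ))) := by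
      refine Continuous.tendsto ?_ 1
      exact Continuous.rpow continuous_const continuous_neg fun s ↦ Or.inl (by positivity)
    rw [Real.rpow_neg_one] at this
    exact this.mono_left nhdsWithin_le_nhds
  · simpa using tendsto_one_div_add_atTop_nhds_zero_nat (𝕜 := ℝ)
  · have h := (differentiable_expZeta_of_ne_zero (coe_addCircle_ne_zero h0 h1)).continuous.tendsto 1
    have h2 : Tendsto (fun s : ℝ ↦ (s : ℂ)) (𝓝[>] 1) (𝓝 1) := by
      have := (continuous_ofReal.tendsto (1 : ℝ)).mono_left (nhdsWithin_le_nhds (s := Set.Ioi 1))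
      simpa using this
    exact h.comp h2

/-- Follows from `1 - exp (2 i θ) = 2 sin θ * exp (i (θ - π / 2))` with `θ = π x`. -/
theorem arg_one_sub_exp {x : ℝ} (h0 : 0 < x) (h1 : x < 1) :
    arg (1 - cexp (2 * π * I * x)) = π * x - π / 2 := by
  have hpi := Real.pi_pos
  have hs : 0 < Real.sin (π * x) := Real.sin_pos_of_pos_of_lt_pi (by positivity) (by nlinarith)
  have e : 1 - cexp (2 * π * I * x) = ((2 * Real.sin (π * x) : ℝ) : ℂ) *
      (Complex.cos ((π * x - π / 2 : ℝ) : ℂ) + Complex.sin ((π * x - π / 2 : ℝ) : ℂ) * I) := by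
    rw [show 2 * (π : ℂ) * I * x = ((2 * (π * x) : ℝ) : ℂ) * I by push_cast; ring,
      Complex.exp_mul_I, ← ofReal_cos, ← ofReal_sin, ← ofReal_cos, ← ofReal_sin,
      Real.cos_sub_pi_div_two, Real.sin_sub_pi_div_two, Real.cos_two_mul, Real.sin_two_mul]
    push_cast
    linear_combination -2 * Complex.sin_sq_add_cos_sq (π * x)
  rw [e]
  exact arg_mul_cos_add_sin_mul_I (by positivity) ⟨by nlinarith, by nlinarith⟩

/-- The value of the Hurwitz zeta function at `s = 0`, the case not covered by
`HurwitzZeta.hurwitzZeta_neg_nat`; it comes from the functional equation and the value of the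
exponential zeta function at `s = 1`. -/
theorem hurwitzZeta_apply_zero {x : ℝ} (h0 : 0 < x) (h1 : x < 1) :
    hurwitzZeta x 0 = 1 / 2 - x := by
  have hx := coe_addCircle_ne_zero h0 h1
  have h := hurwitzZeta_one_sub (x : UnitAddCircle) (s := 1)
    (fun n hn ↦ by
      have := congrArg re hn
      simp at this
      have h2 : (0 : ℝ) ≤ n := n.cast_nonneg
      linarith) (Or.inl hx)
  -- `expZeta (-x) 1` is the complex conjugate of `expZeta x 1`, so only the imaginary part of the
  -- logarithm, that is an argument, enters.
  have hneg : (-(x : UnitAddCircle)) = ((1 - x : ℝ) : UnitAddCircle) := by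
    rw [AddCircle.coe_sub, AddCircle.coe_period, zero_sub]
  have he : cexp (2 * π * I * ((1 - x : ℝ) : ℂ)) = (starRingEnd ℂ) (cexp (2 * π * I * x)) := by
    rw [← exp_conj, show 2 * (π : ℂ) * I * ((1 - x : ℝ) : ℂ) = 2 * π * I - 2 * π * I * x by
      push_cast; ring, Complex.exp_sub, exp_two_pi_mul_I]
    simp [Complex.exp_neg, Complex.conj_ofNat]
  have harg := arg_one_sub_exp h0 h1
  have hne : arg (1 - cexp (2 * π * I * x)) ≠ π := by
    rw [harg]; have := Real.pi_pos; nlinarith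
  have hlog : log (1 - (starRingEnd ℂ) (cexp (2 * π * I * x)))
      = (starRingEnd ℂ) (log (1 - cexp (2 * π * I * x))) := by
    rw [← log_conj _ hne]; simp
  rw [hneg, expZeta_one h0 h1, expZeta_one (by linarith) (by linarith), he, hlog] at h
  have him : (log (1 - cexp (2 * π * I * x))).im = π * x - π / 2 := by rw [log_im, harg]
  set l := log (1 - cexp (2 * π * I * x))
  have hE1 : cexp (-π * I * 1 / 2) = -I := by
    rw [show -(π : ℂ) * I * 1 / 2 = -(π / 2 * I) by ring, Complex.exp_neg, exp_pi_div_two_mul_I]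
    simp
  have hE2 : cexp (π * I * 1 / 2) = I := by
    rw [show (π : ℂ) * I * 1 / 2 = (π / 2 * I) by ring, exp_pi_div_two_mul_I]
  rw [sub_self, hE1, hE2, Complex.Gamma_one, cpow_neg_one] at h
  rw [h]
  have : (-I * -l + I * -(starRingEnd ℂ) l) = ((-2 * (π * x - π / 2) : ℝ) : ℂ) := by
    rw [← him]
    apply Complex.ext
    · simp; ring
    · simp
  rw [this]
  have hpi : (π : ℂ) ≠ 0 := by exact_mod_cast Real.pi_ne_zero
  push_cast
  field_simp
  ring

theorem ne_one_of_odd {n : ℕ} {χ : DirichletCharacter ℂ n} (ho : χ.Odd) : χ ≠ 1 := by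
  rintro rfl
  rw [DirichletCharacter.Odd, MulChar.one_apply isUnit_one.neg] at ho
  norm_num at ho

/-- The generalized Bernoulli number `B_{1,χ}` of an odd primitive character does not vanish. The
sum is `n * B_{1,χ} = -n * L(0, χ)`, and the functional equation relates `L(0, χ)` to
`L(1, χ⁻¹) ≠ 0`. -/
theorem sum_mul_val_ne_zero {n : ℕ} [NeZero n] {χ : DirichletCharacter ℂ n} (hp : χ.IsPrimitive)
    (ho : χ.Odd) : ∑ j : ZMod n, χ j * (j.val : ℂ) ≠ 0 := by
  have hne : χ ≠ 1 := ne_one_of_odd ho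
  have hn : n ≠ 1 := fun h ↦ hne (DirichletCharacter.level_one' _ h)
  have hinv : χ⁻¹.IsPrimitive := by
    rw [DirichletCharacter.isPrimitive_def, DirichletCharacter.conductor_inv]; exact hp
  have hL1 : DirichletCharacter.LFunction χ⁻¹ 1 ≠ 0 :=
    DirichletCharacter.LFunction_apply_one_ne_zero (inv_ne_one.2 hne)
  have hΛ : DirichletCharacter.completedLFunction χ 0 ≠ 0 := by
    intro h0
    apply hL1
    -- Using the functional equation of `χ⁻¹`, not that of `χ`, makes it unnecessary to know that the
    -- root number is nonzero.
    have h := hinv.completedLFunction_one_sub 0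
    rw [sub_zero, inv_inv, h0, mul_zero] at h
    rw [DirichletCharacter.LFunction_eq_completed_div_gammaFactor _ _ (Or.inr hn), h, zero_div]
  have hL0 : DirichletCharacter.LFunction χ 0 ≠ 0 := by
    rw [DirichletCharacter.LFunction_eq_completed_div_gammaFactor _ _ (Or.inr hn),
      ho.gammaFactor_def]
    refine div_ne_zero hΛ (Gammaℝ_ne_zero_of_re_pos (by simp))
  intro hB
  apply hL0
  rw [DirichletCharacter.LFunction, ZMod.LFunction, neg_zero, cpow_zero, one_mul]
  have hterm : ∀ j : ZMod n, χ j * hurwitzZeta (ZMod.toAddCircle j) 0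
      = χ j * (1 / 2) - χ j * j.val * (n : ℂ)⁻¹ := by
    intro j
    rcases eq_or_ne j 0 with rfl | hj
    -- The term `j = 0`, where the formula for the Hurwitz zeta function is false, has `χ j = 0`.
    · rw [χ.map_zero' hn]; simp
    · have hn0 : (0 : ℝ) < n := Nat.cast_pos.2 (NeZero.pos n)
      have hv : 0 < j.val := Nat.pos_of_ne_zero fun h ↦ hj ((ZMod.val_eq_zero j).1 h)
      rw [ZMod.toAddCircle_apply, hurwitzZeta_apply_zero]
      · push_cast; ring
      · positivity
      · rw [div_lt_one hn0]; exact_mod_cast ZMod.val_lt j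
  rw [Finset.sum_congr rfl fun j _ ↦ hterm j, Finset.sum_sub_distrib, ← Finset.sum_mul,
    ← Finset.sum_mul, hB, MulChar.sum_eq_zero_of_ne_one hne]
  simp

end Analysis

/-! ### The projection to primitive characters -/

open Classical in
/-- The factor at one prime of the kernel of the projection to primitive characters. For `L ∩ K = 1`
it is, up to the scalar `|K| / (|K| - 1)`, the function `1_L - |K|⁻¹ 1_{KL}`, normalized to take the
value `1` at `1`. -/
noncomputable def localWeight {G : Type*} [CommGroup G] (K L : Subgroup G) (y : G) : ℝ :=
  if y ∈ L then 1 else if y ∈ K ⊔ L then -1 / ((Nat.card K : ℝ) - 1) else 0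

/-- `localWeight K L` has sum `0` over every coset of `K`: a coset inside `K ⊔ L` meets `L` in
exactly one point. -/
theorem sum_localWeight_mul_eq_zero {G : Type*} [CommGroup G] [Fintype G] {K L : Subgroup G}
    [Fintype K] (hKL : Disjoint K L) (hK : Nat.card K ≠ 1) (y : G) :
    ∑ k : K, localWeight K L (y * k) = 0 := by
  classical
  by_cases hy : y ∈ K ⊔ L
  · obtain ⟨k₀, hk₀, l, hl, rfl⟩ := Subgroup.mem_sup.1 hy
    have h1 : ∀ k : K, localWeight K L (k₀ * l * k)
        = (if k = ⟨k₀, hk₀⟩⁻¹ then 1 + 1 / ((Nat.card K : ℝ) - 1) else 0)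
          + -1 / ((Nat.card K : ℝ) - 1) := by
      intro k
      have hmem : k₀ * l * k ∈ K ⊔ L := Subgroup.mul_mem _ hy (Subgroup.mem_sup_left k.2)
      have hiff : k₀ * l * k ∈ L ↔ k = ⟨k₀, hk₀⟩⁻¹ := by
        rw [show k₀ * l * k = k₀ * k * l by rw [mul_assoc, mul_comm l, mul_assoc],
          Subgroup.mul_mem_cancel_right _ hl]
        constructor
        · intro h
          have h2 : k₀ * (k : G) = 1 :=
            Subgroup.disjoint_def.1 hKL (K.mul_mem hk₀ k.2) h
          rw [eq_inv_iff_mul_eq_one]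
          ext
          simpa [mul_comm] using h2
        · rintro rfl
          simp
      by_cases hk : k = ⟨k₀, hk₀⟩⁻¹
      · rw [localWeight, if_pos (hiff.2 hk), if_pos hk]; ring
      · rw [localWeight, if_neg (mt hiff.1 hk), if_pos hmem, if_neg hk, zero_add]
    have hc : (Nat.card K : ℝ) - 1 ≠ 0 := sub_ne_zero.2 (by exact_mod_cast hK)
    rw [Finset.sum_congr rfl fun k _ ↦ h1 k, Finset.sum_add_distrib, Finset.sum_ite_eq',
      if_pos (Finset.mem_univ _), Finset.sum_const, Finset.card_univ, ← Nat.card_eq_fintype_card,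
      nsmul_eq_mul]
    field_simp
    ring
  · refine Finset.sum_eq_zero fun k _ ↦ ?_
    have hmem : y * k ∉ K ⊔ L := by
      rwa [Subgroup.mul_mem_cancel_right _ (Subgroup.mem_sup_left k.2)]
    rw [localWeight, if_neg fun h ↦ hmem (Subgroup.mem_sup_right h), if_neg hmem]

theorem localWeight_mul_of_mem {G : Type*} [CommGroup G] {K L : Subgroup G} {k : G} (hk : k ∈ L)
    (y : G) : localWeight K L (y * k) = localWeight K L y := by
  rw [localWeight, localWeight, Subgroup.mul_mem_cancel_right _ hk,
    Subgroup.mul_mem_cancel_right _ (Subgroup.mem_sup_right hk)]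

/-- A product of local weights is orthogonal to every character that is trivial on one of the
subgroups `K p`: only the factor at `p` varies along a coset of `K p`. -/
theorem sum_prod_localWeight_mul_eq_zero {G ι : Type*} [CommGroup G] [Fintype G] {P : Finset ι}
    {K L : ι → Subgroup G} {p : ι} (hp : p ∈ P) (hKL : Disjoint (K p) (L p))
    (hK : Nat.card (K p) ≠ 1) (hne : ∀ q ∈ P, q ≠ p → K p ≤ L q) (χ : G →* ℂ)
    (hχ : ∀ k ∈ K p, χ k = 1) :
    ∑ y, ((∏ q ∈ P, localWeight (K q) (L q) y : ℝ) : ℂ) * χ y = 0 := by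
  classical
  set W : G → ℝ := fun y ↦ ∏ q ∈ P, localWeight (K q) (L q) y with hW
  have hWk : ∀ y, ∑ k : K p, W (y * k) = 0 := by
    intro y
    have : ∀ k : K p, W (y * k)
        = localWeight (K p) (L p) (y * k) * ∏ q ∈ P.erase p, localWeight (K q) (L q) y := by
      intro k
      rw [hW]
      simp only
      rw [← Finset.mul_prod_erase P _ hp]
      congr 1
      refine Finset.prod_congr rfl fun q hq ↦ localWeight_mul_of_mem ?_ y
      exact hne q (Finset.mem_of_mem_erase hq) (Finset.ne_of_mem_erase hq) k.2
    rw [Finset.sum_congr rfl fun k _ ↦ this k, ← Finset.sum_mul,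
      sum_localWeight_mul_eq_zero hKL hK, zero_mul]
  have h1 : ∀ k : K p, ∑ y, (W y : ℂ) * χ y = ∑ y, (W (y * k) : ℂ) * χ y := by
    intro k
    rw [← Equiv.sum_comp (Equiv.mulRight (k : G))]
    refine Finset.sum_congr rfl fun y _ ↦ ?_
    rw [Equiv.coe_mulRight, map_mul, hχ k k.2, mul_one]
  have h2 : (Fintype.card (K p) : ℂ) * ∑ y, (W y : ℂ) * χ y = 0 := by
    calc _ = ∑ _k : K p, ∑ y, (W y : ℂ) * χ y := by
          rw [Finset.sum_const, Finset.card_univ, nsmul_eq_mul]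
      _ = ∑ k : K p, ∑ y, (W (y * k) : ℂ) * χ y := Finset.sum_congr rfl fun k _ ↦ h1 k
      _ = ∑ y, ((∑ k : K p, W (y * k) : ℝ) : ℂ) * χ y := by
          rw [Finset.sum_comm]
          refine Finset.sum_congr rfl fun y _ ↦ ?_
          rw [← Finset.sum_mul]; push_cast; rfl
      _ = 0 := by simp [hWk]
  exact (mul_eq_zero.1 h2).resolve_left (by simp)

/-- The units modulo `n` that are congruent to `1` modulo `m`, for `m ∣ n`. (The `gcd` makes the
definition independent of a proof of divisibility.) -/
def congrSubgroup (n m : ℕ) : Subgroup (ZMod n)ˣ :=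
  (ZMod.unitsMap (Nat.gcd_dvd_left n m)).ker

theorem mem_congrSubgroup {n m : ℕ} [NeZero n] (hm : m ∣ n) {u : (ZMod n)ˣ} :
    u ∈ congrSubgroup n m ↔ (m : ℤ) ∣ ((u : ZMod n).val : ℤ) - 1 := by
  have hg : (n.gcd m : ℤ) = m := by rw [Nat.gcd_eq_right hm]
  rw [congrSubgroup, MonoidHom.mem_ker, Units.ext_iff, ZMod.unitsMap_val, Units.val_one, ← hg,
    ← ZMod.intCast_zmod_eq_zero_iff_dvd, ZMod.cast_eq_val]
  push_cast
  rw [sub_eq_zero]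

theorem card_congrSubgroup {n m : ℕ} [NeZero n] (hm : m ∣ n) :
    Nat.card (congrSubgroup n m) * m.totient = n.totient := by
  have hm0 : m ≠ 0 := fun h ↦ NeZero.ne n (Nat.eq_zero_of_zero_dvd (h ▸ hm))
  have hg : n.gcd m = m := Nat.gcd_eq_right hm
  have : NeZero (n.gcd m) := ⟨by rwa [hg]⟩
  have h1 := Subgroup.card_mul_index (congrSubgroup n m)
  rw [congrSubgroup, Subgroup.index_ker,
    MonoidHom.range_eq_top.2 (ZMod.unitsMap_surjective (Nat.gcd_dvd_left n m)),
    Subgroup.card_top, Nat.card_eq_fintype_card (α := (ZMod (n.gcd m))ˣ),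
    Nat.card_eq_fintype_card (α := (ZMod n)ˣ), ZMod.card_units_eq_totient,
    ZMod.card_units_eq_totient] at h1
  rw [congrSubgroup, ← h1]
  congr 2
  exact hg.symm

theorem card_congrSubgroup_div {n p : ℕ} [NeZero n] (hp : p.Prime) (hpn : p ∣ n) :
    Nat.card (congrSubgroup n (n / p)) = if p ^ 2 ∣ n then p else p - 1 := by
  have h := card_congrSubgroup (Nat.div_dvd_of_dvd hpn)
  have hn : p * (n / p) = n := Nat.mul_div_cancel' hpn
  have hpos : 0 < (n / p).totient :=
    Nat.totient_pos.2 (Nat.div_pos (Nat.le_of_dvd (NeZero.pos n) hpn) hp.pos)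
  have hiff : p ^ 2 ∣ n ↔ p ∣ n / p := by
    rw [pow_two]
    conv_lhs => rw [← hn]
    exact Nat.mul_dvd_mul_iff_left hp.pos
  have h2 : n.totient = (if p ^ 2 ∣ n then p else p - 1) * (n / p).totient := by
    conv_lhs => rw [← hn]
    split_ifs with h3
    · exact Nat.totient_mul_of_prime_of_dvd hp (hiff.1 h3)
    · exact Nat.totient_mul_of_prime_of_not_dvd hp (mt hiff.2 h3)
  exact Nat.eq_of_mul_eq_mul_right hpos (h.trans h2)

theorem unit_eq_one_of_dvd {n : ℕ} [NeZero n] {u : (ZMod n)ˣ}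
    (h : (n : ℤ) ∣ ((u : ZMod n).val : ℤ) - 1) : u = 1 := by
  rw [← ZMod.intCast_zmod_eq_zero_iff_dvd] at h
  push_cast at h
  rw [ZMod.natCast_zmod_val, sub_eq_zero] at h
  exact Units.ext h

theorem disjoint_congrSubgroup {n p : ℕ} [NeZero n] (hp : p.Prime) (hpn : p ∣ n) :
    Disjoint (congrSubgroup n (n / p)) (congrSubgroup n (ordProj[p] n)) := by
  rw [Subgroup.disjoint_def]
  intro u hu hu'
  rw [mem_congrSubgroup (Nat.div_dvd_of_dvd hpn)] at hu
  rw [mem_congrSubgroup (Nat.ordProj_dvd n p)] at hu'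
  apply unit_eq_one_of_dvd
  have hco : Nat.Coprime (ordProj[p] n) (ordCompl[p] n) :=
    Nat.Coprime.pow_left _ (Nat.coprime_ordCompl hp (NeZero.ne n))
  have hdvd : ordCompl[p] n ∣ n / p := by
    have h1 : ordCompl[p] n ∣ p * (n / p) := by
      rw [Nat.mul_div_cancel' hpn]; exact Nat.ordCompl_dvd n p
    exact (Nat.coprime_ordCompl hp (NeZero.ne n)).symm.dvd_of_dvd_mul_left h1
  have h2 := (Nat.isCoprime_iff_coprime.2 hco).mul_dvd hu'
    ((Int.natCast_dvd_natCast.2 hdvd).trans hu)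
  rwa [← Nat.cast_mul, Nat.ordProj_mul_ordCompl_eq_self] at h2

theorem congrSubgroup_div_le {n p q : ℕ} [NeZero n] (hp : p.Prime) (hq : q.Prime) (hpn : p ∣ n)
    (hqp : q ≠ p) : congrSubgroup n (n / p) ≤ congrSubgroup n (ordProj[q] n) := by
  intro u hu
  rw [mem_congrSubgroup (Nat.div_dvd_of_dvd hpn)] at hu
  rw [mem_congrSubgroup (Nat.ordProj_dvd n q)]
  refine (Int.natCast_dvd_natCast.2 ?_).trans hu
  have h1 : ordProj[q] n ∣ p * (n / p) := by
    rw [Nat.mul_div_cancel' hpn]; exact Nat.ordProj_dvd n q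
  exact (Nat.Coprime.pow_left _ ((Nat.coprime_primes hq hp).2 hqp)).dvd_of_dvd_mul_left h1

theorem eq_one_of_forall_mem_congrSubgroup {n : ℕ} [NeZero n] {u : (ZMod n)ˣ}
    (h : ∀ p ∈ n.primeFactors, u ∈ congrSubgroup n (ordProj[p] n)) : u = 1 := by
  apply unit_eq_one_of_dvd
  rw [Int.natCast_dvd, Nat.dvd_iff_prime_pow_dvd_dvd]
  intro p k hp hk
  rcases k.eq_zero_or_pos with rfl | hk0
  · simp
  · have hpn : p ∣ n := (dvd_pow_self p hk0.ne').trans hk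
    have h1 := h p (Nat.mem_primeFactors.2 ⟨hp, hpn, NeZero.ne n⟩)
    rw [mem_congrSubgroup (Nat.ordProj_dvd n p), Int.natCast_dvd] at h1
    refine (Nat.pow_dvd_pow p ?_).trans h1
    exact (hp.pow_dvd_iff_le_factorization (NeZero.ne n)).1 hk

/-- An imprimitive character modulo `n` factors through `n / p` for some prime `p ∣ n`. -/
theorem exists_prime_of_not_isPrimitive {n : ℕ} [NeZero n] {χ : DirichletCharacter ℂ n}
    (hχ : ¬ χ.IsPrimitive) :
    ∃ p ∈ n.primeFactors, ∀ u ∈ congrSubgroup n (n / p), χ (u : ZMod n) = 1 := by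
  have hc : χ.conductor ∣ n := χ.conductor_dvd_level
  have hne : n / χ.conductor ≠ 1 := by
    intro h
    apply hχ
    have := Nat.div_mul_cancel hc
    rw [h, one_mul] at this
    exact this
  obtain ⟨p, hp, hpd⟩ := Nat.exists_prime_and_dvd hne
  have hpn : p ∣ n := hpd.trans (Nat.div_dvd_of_dvd hc)
  refine ⟨p, Nat.mem_primeFactors.2 ⟨hp, hpn, NeZero.ne n⟩, fun u hu ↦ ?_⟩
  have hcd : χ.conductor ∣ n.gcd (n / p) := by
    refine Nat.dvd_gcd hc ?_
    rw [Nat.dvd_div_iff_mul_dvd hpn]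
    rw [Nat.dvd_div_iff_mul_dvd hc] at hpd
    rwa [mul_comm]
  have hf := χ.factorsThrough_conductor.mono χ hcd (Nat.gcd_dvd_left _ _)
  rw [DirichletCharacter.factorsThrough_iff_ker_unitsMap (Nat.gcd_dvd_left _ _)] at hf
  have h1 := hf hu
  rw [MonoidHom.mem_ker, Units.ext_iff] at h1
  simpa using h1

/-- The convolution kernel on `(ℤ/n)ˣ` of the projection to the span of the primitive characters,
normalized by the value `1` at `1`. It is the product over the primes `p ∣ n` of local weights with
`K` the units congruent to `1` modulo `n / p` and `L` the units congruent to `1` modulo the full power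
of `p` dividing `n`. -/
noncomputable def primitiveWeight {n : ℕ} (y : (ZMod n)ˣ) : ℝ :=
  ∏ p ∈ n.primeFactors, localWeight (congrSubgroup n (n / p)) (congrSubgroup n (ordProj[p] n)) y

theorem eq_zero_of_forall_character_sum_eq_zero {n : ℕ} [NeZero n] {F : (ZMod n)ˣ → ℂ}
    (h : ∀ χ : DirichletCharacter ℂ n, ∑ x : (ZMod n)ˣ, χ (x : ZMod n) * F x = 0)
    (y : (ZMod n)ˣ) : F y = 0 := by
  have h1 : ∑ χ : DirichletCharacter ℂ n, χ (y : ZMod n)⁻¹ * ∑ x : (ZMod n)ˣ, χ (x : ZMod n) * F x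
      = n.totient * F y := by
    simp only [Finset.mul_sum, ← mul_assoc]
    rw [Finset.sum_comm]
    simp only [← Finset.sum_mul, DirichletCharacter.sum_char_inv_mul_char_eq ℂ y.isUnit,
      Units.val_inj, ite_mul, zero_mul, Finset.sum_ite_eq, Finset.mem_univ, if_true]
  simp only [h, mul_zero, Finset.sum_const_zero] at h1
  refine (mul_eq_zero.1 h1.symm).resolve_left ?_
  exact_mod_cast (Nat.totient_pos.2 (NeZero.pos n)).ne'

theorem sum_primitiveWeight_eq_zero {n : ℕ} [NeZero n] {χ : DirichletCharacter ℂ n}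
    (h2 : Nat.Coprime n 2) (hχ : ¬ χ.IsPrimitive) :
    ∑ y : (ZMod n)ˣ, (primitiveWeight y : ℂ) * χ (y : ZMod n) = 0 := by
  obtain ⟨p, hp, hk⟩ := exists_prime_of_not_isPrimitive hχ
  have hpp := Nat.prime_of_mem_primeFactors hp
  have hpn := Nat.dvd_of_mem_primeFactors hp
  have hp2 : p ≠ 2 := by
    rintro rfl
    have := Nat.dvd_gcd hpn (dvd_refl 2)
    rw [h2] at this
    norm_num at this
  -- For `p = 2` exactly dividing `n` the subgroup `K` is trivial and `|K| - 1` vanishes.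
  have hp3 : 2 < p := lt_of_le_of_ne hpp.two_le hp2.symm
  exact sum_prod_localWeight_mul_eq_zero (P := n.primeFactors)
    (K := fun p ↦ congrSubgroup n (n / p)) (L := fun p ↦ congrSubgroup n (ordProj[p] n)) hp
    (disjoint_congrSubgroup hpp hpn)
    (by rw [card_congrSubgroup_div hpp hpn]; split_ifs <;> lia)
    (fun q hq hqp ↦ congrSubgroup_div_le hpp (Nat.prime_of_mem_primeFactors hq) hpn hqp)
    ((χ : ZMod n →* ℂ).comp (Units.coeHom (ZMod n))) hk

/-- A family of units killed by all odd primitive characters is killed by convolution with the odd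
part of `primitiveWeight`: the convolution has vanishing Fourier coefficients at the even, at the
imprimitive, and at the odd primitive characters. -/
theorem sum_primitiveWeight_sub_eq_zero {n : ℕ} [NeZero n] (h2 : Nat.Coprime n 2)
    {ι : Type*} [Fintype ι] {a : ι → (ZMod n)ˣ}
    (ha : ∀ χ : DirichletCharacter ℂ n, χ.IsPrimitive → χ.Odd → ∑ i, χ (a i : ZMod n) = 0)
    (x : (ZMod n)ˣ) :
    ∑ i, (primitiveWeight (a i / x) - primitiveWeight (-a i / x)) = 0 := by
  have key := eq_zero_of_forall_character_sum_eq_zero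
    (F := fun x ↦ ∑ i, ((primitiveWeight (a i / x) : ℂ) - (primitiveWeight (-a i / x) : ℂ))) ?_ x
  · exact_mod_cast key
  intro χ
  have h1 : ∀ b : (ZMod n)ˣ, ∑ x : (ZMod n)ˣ, χ (x : ZMod n) * (primitiveWeight (b / x) : ℂ)
      = χ (b : ZMod n) * ∑ y : (ZMod n)ˣ, (primitiveWeight y : ℂ) * χ⁻¹ (y : ZMod n) := by
    intro b
    rw [← Equiv.sum_comp (Equiv.divLeft b), Finset.mul_sum]
    refine Finset.sum_congr rfl fun y _ ↦ ?_
    rw [Equiv.divLeft_apply, div_div_cancel, div_eq_mul_inv, Units.val_mul, map_mul,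
      MulChar.inv_apply, Ring.inverse_unit]
    ring
  have h3 : ∑ x : (ZMod n)ˣ, χ (x : ZMod n) *
        ∑ i, ((primitiveWeight (a i / x) : ℂ) - (primitiveWeight (-a i / x) : ℂ))
      = (∑ i, (χ (a i : ZMod n) - χ ((-a i : (ZMod n)ˣ) : ZMod n))) *
        ∑ y : (ZMod n)ˣ, (primitiveWeight y : ℂ) * χ⁻¹ (y : ZMod n) := by
    simp_rw [Finset.mul_sum _ _ (χ _), mul_sub]
    rw [Finset.sum_comm, Finset.sum_mul]
    refine Finset.sum_congr rfl fun i _ ↦ ?_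
    rw [Finset.sum_sub_distrib, h1, h1, sub_mul]
  rw [h3]
  by_cases hp : χ.IsPrimitive
  · rcases χ.even_or_odd with he | ho
    · simp [he.eval_neg]
    · simp only [Units.val_neg, ho.eval_neg, sub_neg_eq_add, Finset.sum_add_distrib,
        ha χ hp ho, add_zero, zero_mul]
  · rw [sum_primitiveWeight_eq_zero h2, mul_zero]
    rw [DirichletCharacter.isPrimitive_def, DirichletCharacter.conductor_inv]
    exact hp

/-! ### Residue sums and odd primitive characters -/

theorem natCast_val_sum {n : ℕ} [NeZero n] {ι : Type*} [Fintype ι] (a : ι → ZMod n) :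
    ((∑ i, (a i).val : ℕ) : ZMod n) = ∑ i, a i := by
  push_cast
  simp

theorem dvd_sum_val {n : ℕ} [NeZero n] {ι : Type*} [Fintype ι] {a : ι → ZMod n}
    (h0 : ∑ i, a i = 0) (x : ZMod n) : n ∣ ∑ i, (x * a i).val := by
  rw [← ZMod.natCast_eq_zero_iff, natCast_val_sum, ← Finset.mul_sum, h0, mul_zero]

theorem sum_val_pos {n : ℕ} [NeZero n] (hn : 1 < n) {ι : Type*} [Fintype ι] [Nonempty ι]
    (a : ι → (ZMod n)ˣ) : 0 < ∑ i, (a i : ZMod n).val := by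
  have : Fact (1 < n) := ⟨hn⟩
  refine Finset.sum_pos (fun i _ ↦ Nat.pos_of_ne_zero fun h ↦ ?_) Finset.univ_nonempty
  exact (a i).ne_zero ((ZMod.val_eq_zero _).1 h)

/-- The sums for `u` and for `-u` are positive multiples of `n` with total `4 n`, so if `n` never
occurs, then each of them is `2 n`. -/
theorem sum_val_eq_two_mul {n : ℕ} [NeZero n] (hn : 1 < n) {a : Fin 4 → (ZMod n)ˣ}
    (h0 : ∑ i, (a i : ZMod n) = 0)
    (h : ∀ u : (ZMod n)ˣ, ∑ i, ((u : ZMod n) * a i).val ≠ n) (u : (ZMod n)ˣ) :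
    ∑ i, ((u : ZMod n) * a i).val = 2 * n := by
  have : Fact (1 < n) := ⟨hn⟩
  have hsum : ∑ i, ((u : ZMod n) * a i).val + ∑ i, (((-u : (ZMod n)ˣ) : ZMod n) * a i).val
      = 4 * n := by
    rw [← Finset.sum_add_distrib]
    have hadd : ∀ i, ((u : ZMod n) * a i).val + (((-u : (ZMod n)ˣ) : ZMod n) * a i).val = n := by
      intro i
      have hne : NeZero ((u : ZMod n) * (a i : ZMod n)) := ⟨(u * a i).ne_zero⟩
      rw [Units.val_neg, neg_mul, ZMod.val_neg_of_ne_zero]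
      have := ZMod.val_lt ((u : ZMod n) * (a i : ZMod n))
      lia
    rw [Finset.sum_congr rfl fun i _ ↦ hadd i]
    simp
  obtain ⟨k, hk⟩ := dvd_sum_val h0 (u : ZMod n)
  obtain ⟨l, hl⟩ := dvd_sum_val h0 ((-u : (ZMod n)ˣ) : ZMod n)
  have hp := sum_val_pos hn fun i ↦ u * a i
  have hp' := sum_val_pos hn fun i ↦ -u * a i
  have h1 := h u
  have h2 := h (-u)
  simp only [Units.val_mul] at hp hp'
  rw [hk] at hp h1 hsum ⊢
  rw [hl] at hp' h2 hsum
  have hkl : k + l = 4 := by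
    rw [← mul_add, mul_comm] at hsum
    exact Nat.eq_of_mul_eq_mul_right (by lia) hsum
  have hk0 : k ≠ 0 := by rintro rfl; simp at hp
  have hl0 : l ≠ 0 := by rintro rfl; simp at hp'
  have hk1 : k ≠ 1 := by rintro rfl; simp at h1
  have hl1 : l ≠ 1 := by rintro rfl; simp at h2
  obtain rfl : k = 2 := by lia
  ring

/-- Summing the constant `∑ i, (u a_i)_n` against `χ⁻¹ u` gives
`0 = (∑ i, χ (a i)) * ∑ y, χ⁻¹ y * (y)_n`, whose second factor is nonzero. -/
theorem sum_character_eq_zero {n : ℕ} [NeZero n] {ι : Type*} [Fintype ι] {a : ι → (ZMod n)ˣ}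
    {c : ℕ} (h : ∀ u : (ZMod n)ˣ, ∑ i, ((u : ZMod n) * a i).val = c)
    {χ : DirichletCharacter ℂ n} (hp : χ.IsPrimitive) (ho : χ.Odd) :
    ∑ i, χ (a i : ZMod n) = 0 := by
  have hp' : χ⁻¹.IsPrimitive := by
    rw [DirichletCharacter.isPrimitive_def, DirichletCharacter.conductor_inv]; exact hp
  have hinv : ∀ u : (ZMod n)ˣ, χ⁻¹ (u : ZMod n) = χ ((u⁻¹ : (ZMod n)ˣ) : ZMod n) := fun u ↦ by
    rw [MulChar.inv_apply, Ring.inverse_unit]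
  have ho' : χ⁻¹.Odd := by
    have := hinv (-1)
    rw [inv_neg_one] at this
    rw [DirichletCharacter.Odd]
    simpa using this.trans ho
  have hne : χ⁻¹ ≠ 1 := ne_one_of_odd ho'
  have h1 : ∑ x : ZMod n, χ⁻¹ x * ((∑ i, (x * a i).val : ℕ) : ℂ) = 0 := by
    have : ∀ x : ZMod n, χ⁻¹ x * ((∑ i, (x * a i).val : ℕ) : ℂ) = χ⁻¹ x * c := by
      intro x
      by_cases hx : IsUnit x
      · obtain ⟨u, rfl⟩ := hx
        rw [h u]
      · rw [χ⁻¹.map_nonunit hx, zero_mul, zero_mul]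
    rw [Finset.sum_congr rfl fun x _ ↦ this x, ← Finset.sum_mul, MulChar.sum_eq_zero_of_ne_one hne,
      zero_mul]
  have h2 : ∑ x : ZMod n, χ⁻¹ x * ((∑ i, (x * a i).val : ℕ) : ℂ)
      = (∑ i, χ (a i : ZMod n)) * ∑ y : ZMod n, χ⁻¹ y * (y.val : ℂ) := by
    push_cast
    simp_rw [Finset.mul_sum]
    rw [Finset.sum_comm]
    simp_rw [← Finset.mul_sum]
    rw [Finset.sum_mul]
    refine Finset.sum_congr rfl fun i _ ↦ ?_
    rw [← Equiv.sum_comp (Units.mulRight (a i)) fun y ↦ χ⁻¹ y * (y.val : ℂ), Finset.mul_sum]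
    refine Finset.sum_congr rfl fun x _ ↦ ?_
    rw [Units.mulRight_apply, map_mul, hinv (a i)]
    have h3 : χ (a i : ZMod n) * χ ((((a i)⁻¹ : (ZMod n)ˣ)) : ZMod n) = 1 := by
      rw [← map_mul, Units.mul_inv, map_one]
    linear_combination (-(χ⁻¹ x * ((x * a i).val : ℂ))) * h3
  rw [h2] at h1
  exact (mul_eq_zero.1 h1).resolve_right (sum_mul_val_ne_zero hp' ho')

/-! ### Bounds for the weight -/

theorem localWeight_of_not_mem {G : Type*} [CommGroup G] {K L : Subgroup G} {y : G} {m : ℕ}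
    (hm : 0 < m) (hK : m + 1 ≤ Nat.card K) (hy : y ∉ L) :
    localWeight K L y ≤ 0 ∧ |localWeight K L y| ≤ 1 / m := by
  have hm' : (0 : ℝ) < m := Nat.cast_pos.2 hm
  have hc : (m : ℝ) ≤ (Nat.card K : ℝ) - 1 := by
    have : ((m + 1 : ℕ) : ℝ) ≤ Nat.card K := Nat.cast_le.2 hK
    push_cast at this
    linarith
  rw [localWeight, if_neg hy]
  split_ifs
  · have h1 : -1 / ((Nat.card K : ℝ) - 1) ≤ 0 :=
      div_nonpos_of_nonpos_of_nonneg (by norm_num) (by linarith)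
    refine ⟨h1, ?_⟩
    rw [abs_of_nonpos h1, neg_div, neg_neg]
    exact one_div_le_one_div_of_le hm' hc
  · simp [hm'.le]

theorem abs_localWeight_le_one {G : Type*} [CommGroup G] {K L : Subgroup G}
    (hK : 2 ≤ Nat.card K) (y : G) : |localWeight K L y| ≤ 1 := by
  by_cases hy : y ∈ L
  · rw [localWeight, if_pos hy, abs_one]
  · simpa using (localWeight_of_not_mem (m := 1) one_pos hK hy).2

theorem prime_factor_cases {n : ℕ} (h6 : Nat.Coprime n 6) (h7 : Nat.Coprime n 7) {p : ℕ}
    (hp : p ∈ n.primeFactors) : p = 5 ∨ 11 ≤ p := by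
  have hpp := Nat.prime_of_mem_primeFactors hp
  have hpn := Nat.dvd_of_mem_primeFactors hp
  have h6' := Nat.Coprime.coprime_dvd_left hpn h6
  have h7' := Nat.Coprime.coprime_dvd_left hpn h7
  by_contra! h
  obtain ⟨h5, h11⟩ := h
  interval_cases p <;> revert hpp h6' h7' <;> first | decide | simp_all

theorem primitiveWeight_one {n : ℕ} : primitiveWeight (1 : (ZMod n)ˣ) = 1 :=
  Finset.prod_eq_one fun _ _ ↦ if_pos (Subgroup.one_mem _)

section Bounds

variable {n : ℕ} [NeZero n]

theorem pred_le_card_congrSubgroup {p : ℕ} (hp : p ∈ n.primeFactors) :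
    p - 1 ≤ Nat.card (congrSubgroup n (n / p)) := by
  rw [card_congrSubgroup_div (Nat.prime_of_mem_primeFactors hp) (Nat.dvd_of_mem_primeFactors hp)]
  split_ifs <;> lia

theorem exists_not_mem_congrSubgroup {y : (ZMod n)ˣ} (hy : y ≠ 1) :
    ∃ p ∈ n.primeFactors, y ∉ congrSubgroup n (ordProj[p] n) := by
  by_contra! h
  exact hy (eq_one_of_forall_mem_congrSubgroup h)

theorem localWeight_congrSubgroup_of_not_mem (h6 : Nat.Coprime n 6) (h7 : Nat.Coprime n 7) {p : ℕ}
    (hp : p ∈ n.primeFactors) {y : (ZMod n)ˣ} (hy : y ∉ congrSubgroup n (ordProj[p] n)) :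
    localWeight (congrSubgroup n (n / p)) (congrSubgroup n (ordProj[p] n)) y ≤ 0 ∧
    |localWeight (congrSubgroup n (n / p)) (congrSubgroup n (ordProj[p] n)) y| ≤ 1 / 3 ∧
    (p ≠ 5 →
      |localWeight (congrSubgroup n (n / p)) (congrSubgroup n (ordProj[p] n)) y| ≤ 1 / 9) := by
  have hc := pred_le_card_congrSubgroup hp
  have h5 := prime_factor_cases h6 h7 hp
  have h3 := localWeight_of_not_mem (K := congrSubgroup n (n / p)) (m := 3) (by norm_num)
    (by lia) hy
  refine ⟨h3.1, by simpa using h3.2, fun hp5 ↦ ?_⟩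
  simpa using (localWeight_of_not_mem (K := congrSubgroup n (n / p)) (m := 9) (by norm_num)
    (by lia) hy).2

theorem abs_primitiveWeight_le_prod (h6 : Nat.Coprime n 6) (h7 : Nat.Coprime n 7) {T : Finset ℕ}
    (hT : T ⊆ n.primeFactors) (y : (ZMod n)ˣ) :
    |primitiveWeight y| ≤ ∏ p ∈ T,
      |localWeight (congrSubgroup n (n / p)) (congrSubgroup n (ordProj[p] n)) y| := by
  rw [primitiveWeight, Finset.abs_prod, ← Finset.prod_sdiff hT]
  refine mul_le_of_le_one_left (Finset.prod_nonneg fun _ _ ↦ abs_nonneg _) ?_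
  refine Finset.prod_le_one (fun _ _ ↦ abs_nonneg _) fun p hpT ↦ ?_
  have hp := (Finset.mem_sdiff.1 hpT).1
  have hc := pred_le_card_congrSubgroup hp
  have h5 := prime_factor_cases h6 h7 hp
  exact abs_localWeight_le_one (by lia) y

/-- A unit `y ≠ 1` fails to be `1` either at a single prime, where the weight is nonpositive, or at
two primes, one of which is at least `11`; then the weight is at most `1 / 3 * 1 / 9`. -/
theorem primitiveWeight_le (h6 : Nat.Coprime n 6) (h7 : Nat.Coprime n 7) {y : (ZMod n)ˣ}
    (hy : y ≠ 1) : primitiveWeight y ≤ 1 / 27 := by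
  obtain ⟨p, hp, hyp⟩ := exists_not_mem_congrSubgroup hy
  obtain ⟨hp0, hp3, hp9⟩ := localWeight_congrSubgroup_of_not_mem h6 h7 hp hyp
  by_cases h : ∃ q ∈ n.primeFactors, q ≠ p ∧ y ∉ congrSubgroup n (ordProj[q] n)
  · obtain ⟨q, hq, hqp, hyq⟩ := h
    obtain ⟨-, hq3, hq9⟩ := localWeight_congrSubgroup_of_not_mem h6 h7 hq hyq
    have h1 := abs_primitiveWeight_le_prod h6 h7 (T := {p, q})
      (by intro x hx; simp only [Finset.mem_insert, Finset.mem_singleton] at hx; grind) y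
    rw [Finset.prod_pair hqp.symm] at h1
    refine (le_abs_self _).trans (h1.trans ?_)
    by_cases hp5 : p = 5
    · calc _ ≤ (1 / 3 : ℝ) * (1 / 9) :=
            mul_le_mul hp3 (hq9 (hp5 ▸ hqp)) (abs_nonneg _) (by norm_num)
        _ = _ := by norm_num
    · calc _ ≤ (1 / 9 : ℝ) * (1 / 3) := mul_le_mul (hp9 hp5) hq3 (abs_nonneg _) (by norm_num)
        _ = _ := by norm_num
  · push Not at h
    have h1 : primitiveWeight y
        = localWeight (congrSubgroup n (n / p)) (congrSubgroup n (ordProj[p] n)) y :=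
      Finset.prod_eq_single_of_mem p hp fun q hq hqp ↦ if_pos (h q hq hqp)
    rw [h1]
    exact hp0.trans (by norm_num)

/-- The negative of the weight can exceed `1 / 9` only at units that are `1` at all primes
except `5`. -/
theorem neg_primitiveWeight_le (h6 : Nat.Coprime n 6) (h7 : Nat.Coprime n 7) (y : (ZMod n)ˣ) :
    -primitiveWeight y ≤ 1 / 9 ∨ (-primitiveWeight y ≤ 1 / 3 ∧
      ∀ q ∈ n.primeFactors, q ≠ 5 → y ∈ congrSubgroup n (ordProj[q] n)) := by
  by_cases h : ∃ q ∈ n.primeFactors, q ≠ 5 ∧ y ∉ congrSubgroup n (ordProj[q] n)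
  · obtain ⟨q, hq, hq5, hyq⟩ := h
    left
    have h1 := abs_primitiveWeight_le_prod h6 h7 (Finset.singleton_subset_iff.2 hq) y
    rw [Finset.prod_singleton] at h1
    exact (neg_le_abs _).trans
      (h1.trans ((localWeight_congrSubgroup_of_not_mem h6 h7 hq hyq).2.2 hq5))
  · push Not at h
    rcases eq_or_ne y 1 with rfl | hy
    · left
      rw [primitiveWeight_one]; norm_num
    · right
      obtain ⟨p, hp, hyp⟩ := exists_not_mem_congrSubgroup hy
      have h1 := abs_primitiveWeight_le_prod h6 h7 (Finset.singleton_subset_iff.2 hp) y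
      rw [Finset.prod_singleton] at h1
      exact ⟨(neg_le_abs _).trans
        (h1.trans (localWeight_congrSubgroup_of_not_mem h6 h7 hp hyp).2.1), h⟩

/-- For a power of `5` other than `5` itself, the subgroup `K` at the prime `5` has order `5`, which
improves the bound `1 / 3` to `1 / 4`. -/
theorem primitiveWeight_of_primeFactors_eq (hn : 5 < n) (h5 : n.primeFactors = {5})
    {y : (ZMod n)ˣ} (hy : y ≠ 1) : primitiveWeight y ≤ 0 ∧ -primitiveWeight y ≤ 1 / 4 := by
  obtain ⟨p, hp, hyp⟩ := exists_not_mem_congrSubgroup hy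
  obtain rfl : p = 5 := by simpa [h5] using hp
  have h25 : 5 ^ 2 ∣ n := by
    have hpow := Nat.eq_prime_pow_of_unique_prime_dvd (n := n) (p := 5) (NeZero.ne n)
      fun {d} hd hdn ↦ by
        have : d ∈ n.primeFactors := Nat.mem_primeFactors.2 ⟨hd, hdn, NeZero.ne n⟩
        simpa [h5] using this
    rw [hpow]
    refine pow_dvd_pow 5 ?_
    by_contra! hlt
    rw [hpow] at hn
    have : 5 ^ n.primeFactorsList.length ≤ 5 ^ 1 := Nat.pow_le_pow_right (by norm_num) (by lia)
    lia
  have hc := card_congrSubgroup_div Nat.prime_five (Nat.dvd_of_mem_primeFactors hp)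
  rw [if_pos h25] at hc
  have h4 := localWeight_of_not_mem (m := 4) (by norm_num) hc.ge hyp
  rw [primitiveWeight, h5, Finset.prod_singleton]
  exact ⟨h4.1, (neg_le_abs _).trans (by simpa using h4.2)⟩

end Bounds

/-! ### The index conjecture -/

/-- If the value `n` were never attained, then evaluating the convolution of
`sum_primitiveWeight_sub_eq_zero` at `a 0` would write `1` as a sum of seven signed weights, which
are too small. -/
theorem exists_sum_val_eq {n : ℕ} [NeZero n] (hn : 5 < n) (h6 : Nat.Coprime n 6)
    (h7 : Nat.Coprime n 7) {a : Fin 4 → (ZMod n)ˣ} (h0 : ∑ i, (a i : ZMod n) = 0)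
    (hne : ∀ i, i ≠ 0 → (a 0 : ZMod n) + a i ≠ 0) :
    ∃ u : (ZMod n)ˣ, ∑ i, ((u : ZMod n) * a i).val = n := by
  by_contra! hcon
  have key := sum_primitiveWeight_sub_eq_zero (Nat.Coprime.coprime_dvd_right (by norm_num) h6)
    (fun χ hp ho ↦ sum_character_eq_zero (sum_val_eq_two_mul (by lia) h0 hcon) hp ho) (a 0)
  have hy : ∀ i, i ≠ 0 → -a i / a 0 ≠ 1 := by
    intro i hi h
    apply hne i hi
    rw [div_eq_one, Units.ext_iff, Units.val_neg] at h
    rw [← h, neg_add_cancel]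
  have hm1 : -a 0 / a 0 ≠ 1 := by
    intro h
    rw [neg_div, div_self', Units.ext_iff, Units.val_neg, Units.val_one] at h
    have : Fact (2 < n) := ⟨by lia⟩
    exact ZMod.neg_one_ne_one h
  rw [Fin.sum_univ_four, div_self', primitiveWeight_one] at key
  by_cases hP : ∃ q ∈ n.primeFactors, q ≠ 5
  · obtain ⟨q, hq, hq5⟩ := hP
    have b0 := primitiveWeight_le h6 h7 hm1
    have b1 := primitiveWeight_le h6 h7 (hy 1 (by decide))
    have b2 := primitiveWeight_le h6 h7 (hy 2 (by decide))
    have b3 := primitiveWeight_le h6 h7 (hy 3 (by decide))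
    rcases neg_primitiveWeight_le h6 h7 (a 1 / a 0) with c1 | ⟨c1, d1⟩ <;>
    rcases neg_primitiveWeight_le h6 h7 (a 2 / a 0) with c2 | ⟨c2, d2⟩ <;>
    rcases neg_primitiveWeight_le h6 h7 (a 3 / a 0) with c3 | ⟨c3, d3⟩ <;>
    -- Unless all three `a i / a 0` are `1` at the primes other than `5`, the total is at most
    -- `4 / 27 + 2 / 3 + 1 / 9 < 1`.
    try linarith
    -- In the remaining case `a 0 + a 1 + a 2 + a 3 = 0` reads `4 = 0` modulo `q`.
    have hqp := Nat.prime_of_mem_primeFactors hq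
    have hqn := Nat.dvd_of_mem_primeFactors hq
    have hqo : (q : ℤ) ∣ (ordProj[q] n : ℕ) :=
      Int.natCast_dvd_natCast.2 (dvd_pow_self q (hqp.factorization_pos_of_dvd (NeZero.ne n) hqn).ne')
    have e1 := hqo.trans ((mem_congrSubgroup (Nat.ordProj_dvd n q)).1 (d1 q hq hq5))
    have e2 := hqo.trans ((mem_congrSubgroup (Nat.ordProj_dvd n q)).1 (d2 q hq hq5))
    have e3 := hqo.trans ((mem_congrSubgroup (Nat.ordProj_dvd n q)).1 (d3 q hq hq5))
    have e : (n : ℤ) ∣ 1 + ((a 1 / a 0 : (ZMod n)ˣ) : ZMod n).val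
        + ((a 2 / a 0 : (ZMod n)ˣ) : ZMod n).val + ((a 3 / a 0 : (ZMod n)ˣ) : ZMod n).val := by
      rw [← ZMod.intCast_zmod_eq_zero_iff_dvd]
      push_cast
      simp only [ZMod.natCast_zmod_val, div_eq_mul_inv, Units.val_mul]
      rw [Fin.sum_univ_four] at h0
      have h1 := (a 0).mul_inv
      linear_combination ((a 0)⁻¹ : (ZMod n)ˣ).val * h0 - h1
    have e' := (Int.natCast_dvd_natCast.2 hqn).trans e
    have e4 : (q : ℤ) ∣ (4 : ℕ) := by
      have := (((e'.sub e1).sub e2).sub e3)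
      convert! this using 1
      push_cast
      ring
    have e5 := Nat.le_of_dvd (by norm_num) (Int.natCast_dvd_natCast.1 e4)
    have := prime_factor_cases h6 h7 hq
    lia
  · push Not at hP
    have h5 : n.primeFactors = {5} := by
      refine Finset.Nonempty.subset_singleton_iff ?_ |>.1 fun q hq ↦ by simp [hP q hq]
      exact Nat.nonempty_primeFactors.2 (by lia)
    -- The three negated weights contribute at most `1 / 4` each, the other four nothing.
    have b0 := (primitiveWeight_of_primeFactors_eq hn h5 hm1).1
    have b1 := (primitiveWeight_of_primeFactors_eq hn h5 (hy 1 (by decide))).1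
    have b2 := (primitiveWeight_of_primeFactors_eq hn h5 (hy 2 (by decide))).1
    have b3 := (primitiveWeight_of_primeFactors_eq hn h5 (hy 3 (by decide))).1
    have hneg : ∀ y : (ZMod n)ˣ, -primitiveWeight y ≤ 1 / 4 := by
      intro y
      rcases eq_or_ne y 1 with rfl | hy1
      · rw [primitiveWeight_one]; norm_num
      · exact (primitiveWeight_of_primeFactors_eq hn h5 hy1).2
    have c1 := hneg (a 1 / a 0)
    have c2 := hneg (a 2 / a 0)
    have c3 := hneg (a 3 / a 0)
    linarith

theorem weight_univ_map {n : ℕ} (a : Fin 4 → ZMod n) (g : ℕ) :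
    weight (Finset.univ.val.map a) g = ((∑ i, ((g : ZMod n) * a i).val : ℕ) : ℚ) / n := by
  rw [weight, Multiset.map_map]
  rfl

theorem exists_eq_univ_map {α : Type*} {S : Multiset α} (hS : S.card = 4) :
    ∃ a : Fin 4 → α, S = (Finset.univ : Finset (Fin 4)).val.map a := by
  induction S using Quotient.inductionOn with
  | h l =>
    have hl : l.length = 4 := hS
    refine ⟨fun i ↦ l.get (i.cast hl.symm), ?_⟩
    rw [Fin.univ_val_map]
    exact congrArg _ (List.ext_getElem (by simp [hl]) fun i h₁ h₂ ↦ by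
      rw [List.getElem_ofFn]; rfl)

/-- The index conjecture for every `n > 5` coprime to `42`. -/
theorem holdsFor_of_coprime {n : ℕ} [NeZero n] (hn : 5 < n) (h6 : Nat.Coprime n 6)
    (h7 : Nat.Coprime n 7) : HoldsFor n := by
  intro S hS hmin hco
  obtain ⟨a, rfl⟩ := exists_eq_univ_map hS
  have hunit : ∀ i, IsUnit (a i) := fun i ↦ by
    rw [← ZMod.natCast_zmod_val (a i), ZMod.isUnit_iff_coprime]
    exact (hco _ (Multiset.mem_map_of_mem a (Finset.mem_univ_val i))).symm
  choose b hb using hunit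
  obtain rfl : (fun i ↦ (b i : ZMod n)) = a := funext hb
  have h0 : ∑ i, (b i : ZMod n) = 0 := hmin.1
  have hne : ∀ i, i ≠ 0 → (b 0 : ZMod n) + b i ≠ 0 := by
    intro i hi
    have h1 := hmin.2 (({0, i} : Finset (Fin 4)).val.map fun i ↦ (b i : ZMod n))
      (Multiset.map_le_map (Finset.val_le_iff.2 (Finset.subset_univ _)))
    have hcard : (({0, i} : Finset (Fin 4)).val.map fun i ↦ (b i : ZMod n)).card = 2 := by
      rw [Multiset.card_map, Finset.card_val, Finset.card_pair hi.symm]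
    have h2 := h1 (by intro h; rw [h] at hcard; simp at hcard)
      (by intro h; rw [h, hS] at hcard; norm_num at hcard)
    have h3 : (({0, i} : Finset (Fin 4)).val.map fun i ↦ (b i : ZMod n)).sum = b 0 + b i :=
      Finset.sum_pair hi.symm
    rwa [h3] at h2
  have hnQ : (0 : ℚ) < n := Nat.cast_pos.2 (NeZero.pos n)
  refine le_antisymm ?_ ?_
  · obtain ⟨u, hu⟩ := exists_sum_val_eq hn h6 h7 h0 hne
    have hmem : (u : ZMod n).val ∈ coprimeResidues n := by
      rw [coprimeResidues, Finset.mem_filter, Finset.mem_range]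
      exact ⟨ZMod.val_lt _, (ZMod.val_coe_unit_coprime u).symm⟩
    refine (Finset.inf'_le _ hmem).trans ?_
    rw [weight_univ_map, ZMod.natCast_zmod_val, hu, div_self hnQ.ne']
  · refine Finset.le_inf' _ _ fun g hg ↦ ?_
    rw [coprimeResidues, Finset.mem_filter] at hg
    obtain ⟨u, hu⟩ : IsUnit (g : ZMod n) := (ZMod.isUnit_iff_coprime g n).2 hg.2.symm
    rw [weight_univ_map, one_le_div hnQ, Nat.cast_le, ← hu]
    refine Nat.le_of_dvd ?_ (dvd_sum_val h0 _)
    exact sum_val_pos (by lia) fun i ↦ u * b i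

end IndexConjecture

theorem mainTheorem2 (n : ℕ) [NeZero n] (h6 : Nat.Coprime n 6) (h7 : Nat.Coprime n 7) :
    (34 * 10 ^ 12 < n → IndexConjecture.HoldsFor n) ∧
    (Nat.Coprime n 11 → 29 * 10 ^ 12 < n → IndexConjecture.HoldsFor n) ∧
    (Nat.Coprime n 11 → Nat.Coprime n 13 → 26 * 10 ^ 12 < n → IndexConjecture.HoldsFor n) ∧
    (Nat.Coprime n 11 → Nat.Coprime n 13 → Nat.Coprime n 17 →
      23 * 10 ^ 12 < n → IndexConjecture.HoldsFor n) ∧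
    (Nat.Coprime n 11 → Nat.Coprime n 13 → Nat.Coprime n 17 → Nat.Coprime n 19 →
      22 * 10 ^ 12 < n → IndexConjecture.HoldsFor n) := by
  have key : ∀ N, 5 ≤ N → N < n → IndexConjecture.HoldsFor n := fun N h5 hN ↦
    IndexConjecture.holdsFor_of_coprime (h5.trans_lt hN) h6 h7
  exact ⟨key _ (by norm_num), fun _ ↦ key _ (by norm_num), fun _ _ ↦ key _ (by norm_num),
    fun _ _ _ ↦ key _ (by norm_num), fun _ _ _ _ ↦ key _ (by norm_num)⟩
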